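/- Let $\mathcal A$ be a finite set, and for $j\in\mathcal A$ let $f_j(x)=r_jx+b_j$ with $0<r_j<1$ and $b_j\in\mathbb R$. Let $F\subset[0,1]$ be a nonempty set with $F=\bigcup_{j\in\mathcal A}f_j(F)$ (a self-similar set associated to the maps $f_j$), and assume that $F$ is not a singleton. Suppose that $\log r_j/\log r_\ell$ is irrational for some $j\neq\ell$ in $\mathcal A$. Let $\mu$ be any self-similar measure associated to these same maps, that is, a Borel probability measure on $\mathbb R$ such that $\mu=\sum_{j\in\mathcal A}p_j\,(f_j)_*\mu$ for some weights $0<p_j<1$ with $\sum_{j\in\mathcal A}p_j=1$. (If $F$ is compact, such a measure is automatically supported on $F$.) Then $$\widehat\mu(\xi)=\int e^{-2\pi i\xi x}\,d\mu(x)\longrightarrow 0\qquad\text{as } |\xi|\to\infty,\ \xi\in\mathbb R .$$ No separation condition is assumed on the maps $f_j$. -/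

import Mathlib

open MeasureTheory Filter Topology

noncomputable section

/-- The map `x ↦ r x + b` of the real line; a contracting similitude when `0 < r < 1`. -/
def similitude (r b : ℝ) (x : ℝ) : ℝ := r * x + b

/-- `F ⊆ [0,1]` is a self-similar set associated to the maps `f_j(x) = r_j x + b_j`, `j ∈ 𝒜`:
it is a nonempty subset of `[0,1]`, every `f_j` is a contracting similitude, and
`F = ⋃_j f_j(F)`. -/
structure IsSelfSimilarSet {𝒜 : Type*} (r b : 𝒜 → ℝ) (F : Set ℝ) : Prop where
  ratio_pos : ∀ j, 0 < r j
  ratio_lt_one : ∀ j, r j < 1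
  nonempty : F.Nonempty
  subset_unit : F ⊆ Set.Icc 0 1
  eq_iUnion : F = ⋃ j, similitude (r j) (b j) '' F

/-- `μ` is a self-similar measure for the maps `f_j(x) = r_j x + b_j`, `j ∈ 𝒜`: a Borel
probability measure on the line for which there are weights `0 < p_j < 1` with `∑ p_j = 1` and
`μ = ∑_j p_j (f_j)_* μ`. -/
def IsSelfSimilarMeasure {𝒜 : Type*} [Fintype 𝒜] (r b : 𝒜 → ℝ) (μ : Measure ℝ) : Prop :=
  IsProbabilityMeasure μ ∧
    ∃ p : 𝒜 → ℝ, (∀ j, 0 < p j ∧ p j < 1) ∧ ∑ j, p j = 1 ∧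
      μ = ∑ j, ENNReal.ofReal (p j) • μ.map (similitude (r j) (b j))

/-- The Fourier transform `∫ exp(-2π i ξ x) dμ(x)` of a measure on the line. -/
def measureFourier (μ : Measure ℝ) (ξ : ℝ) : ℂ :=
  ∫ x : ℝ, Complex.exp (-2 * Real.pi * Complex.I * ξ * x) ∂μ

/-- A Rajchman measure: the Fourier transform tends to `0` as `|ξ| → ∞`. -/
def IsRajchman (μ : Measure ℝ) : Prop :=
  Tendsto (measureFourier μ) (comap (fun ξ : ℝ => |ξ|) atTop) (𝓝 0)

end

/-! On a logarithmic scale, `g u = ‖charFun μ (exp u)‖ ^ 2` satisfies `g u ≤ ∑ j, p j * g (u - a j)`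
with `a j = -log (r j)`: self-similarity, the triangle inequality and Jensen. By
`eventually_lt_of_le_average`, such a subsolution lies, to the right of a window, below the solution
of the renewal equation whose source is `g` cut off to that window. The upper half of the key
renewal theorem, `renewal_limsup_le`, then bounds `limsup g` by the integral of `g` over the window
divided by the mean step `∑ j, p j * a j`; irrationality of a ratio of logarithms is what makes it
available. Since `F` is not a singleton, the maps have no common fixed point, so `μ` has no atoms
and Wiener's lemma makes the window integral arbitrarily small for windows far to the right. -/

/-! ### Renewal series, solutions and conservation law. -/

/-- The partial sums `∑_{n < N} Pⁿ φ` of the renewal series, where `P` is the averaging operator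
`(P φ)(u) = ∑ j, p j * φ (u - a j)`. -/
def renewalSum {ι : Type*} [Fintype ι] (p a : ι → ℝ) (φ : ℝ → ℝ) : ℕ → ℝ → ℝ
  | 0, _ => 0
  | N + 1, u => φ u + ∑ j, p j * renewalSum p a φ N (u - a j)

section Renewal

variable {ι : Type*} [Fintype ι] {p a : ι → ℝ} {m : ℝ}

lemma renewalSum_add (φ ψ : ℝ → ℝ) (N : ℕ) (u : ℝ) :
    renewalSum p a (fun x => φ x + ψ x) N u = renewalSum p a φ N u + renewalSum p a ψ N u := by
  induction N generalizing u with
  | zero => simp [renewalSum]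
  | succ N ih => simp only [renewalSum, ih, mul_add, Finset.sum_add_distrib]; ring

lemma renewalSum_neg (φ : ℝ → ℝ) (N : ℕ) (u : ℝ) :
    renewalSum p a (fun x => -φ x) N u = -renewalSum p a φ N u := by
  induction N generalizing u with
  | zero => simp [renewalSum]
  | succ N ih => simp only [renewalSum, ih, mul_neg, Finset.sum_neg_distrib]; ring

lemma renewalSum_translate (φ : ℝ → ℝ) (d : ℝ) (N : ℕ) (u : ℝ) :
    renewalSum p a (fun x => φ (x + d)) N u = renewalSum p a φ N (u + d) := by
  induction N generalizing u with
  | zero => simp [renewalSum]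
  | succ N ih => simp only [renewalSum, ih, sub_add_eq_add_sub]

lemma renewalSum_nonneg (hp : ∀ j, 0 ≤ p j) {φ : ℝ → ℝ} (hφ : ∀ x, 0 ≤ φ x) (N : ℕ) (u : ℝ) :
    0 ≤ renewalSum p a φ N u := by
  induction N generalizing u with
  | zero => simp [renewalSum]
  | succ N ih =>
    exact add_nonneg (hφ u) (Finset.sum_nonneg fun j _ => mul_nonneg (hp j) (ih _))

lemma renewalSum_le_succ (hp : ∀ j, 0 ≤ p j) {φ : ℝ → ℝ} (hφ : ∀ x, 0 ≤ φ x) (N : ℕ) (u : ℝ) :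
    renewalSum p a φ N u ≤ renewalSum p a φ (N + 1) u := by
  induction N generalizing u with
  | zero => exact renewalSum_nonneg hp hφ 1 u
  | succ N ih =>
    rw [renewalSum, renewalSum]
    gcongr with j
    · exact hp j
    · exact ih _

lemma renewalSum_eq_zero (ha : ∀ j, 0 ≤ a j) {φ : ℝ → ℝ} {α : ℝ} (hφ : ∀ x < α, φ x = 0)
    (N : ℕ) {u : ℝ} (hu : u < α) : renewalSum p a φ N u = 0 := by
  induction N generalizing u with
  | zero => rfl
  | succ N ih =>
    simp only [renewalSum, hφ u hu, zero_add]
    exact Finset.sum_eq_zero fun j _ => by rw [ih (by linarith [ha j]), mul_zero]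

/-- A function supported in `[α, β]` and bounded by `c` has renewal series bounded by
`c * ((β - α) / m + 1)`, where `m` is a lower bound for the steps. -/
lemma abs_renewalSum_le (hp : ∀ j, 0 ≤ p j) (hp1 : ∑ j, p j = 1) (hm : 0 < m)
    (ha : ∀ j, m ≤ a j) {φ : ℝ → ℝ} {α β c : ℝ} (hαβ : α ≤ β) (hc : ∀ x, |φ x| ≤ c)
    (hφ : ∀ x, x ∉ Set.Icc α β → φ x = 0) (N : ℕ) (u : ℝ) :
    |renewalSum p a φ N u| ≤ c * ((β - α) / m + 1) := by
  have hc0 : 0 ≤ c := (abs_nonneg _).trans (hc 0)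
  -- `V u` bounds the number of visits to `[α, β]` of a walk going left from `u` by steps at least
  -- `m`; a visit at `u` is paid for by `1 + V (u - m) ≤ V u`.
  set V : ℝ → ℝ := fun u => max 0 ((min u β - α) / m + 1) with hV
  have hVmono : Monotone V := fun x y hxy => by simp only [hV]; gcongr
  suffices H : ∀ N u, |renewalSum p a φ N u| ≤ c * V u by
    refine (H N u).trans ?_
    gcongr
    refine max_le (by have : 0 ≤ β - α := by linarith
                      positivity) ?_
    gcongr
    exact min_le_right _ _
  intro N
  induction N with
  | zero => intro u; simpa [renewalSum] using mul_nonneg hc0 (le_max_left _ _)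
  | succ N ih =>
    intro u
    have h1 : |∑ j, p j * renewalSum p a φ N (u - a j)| ≤ c * V (u - m) := by
      calc _ ≤ ∑ j, |p j * renewalSum p a φ N (u - a j)| := Finset.abs_sum_le_sum_abs _ _
        _ ≤ ∑ j, p j * (c * V (u - m)) := by
            gcongr with j
            rw [abs_mul, abs_of_nonneg (hp j)]
            refine mul_le_mul_of_nonneg_left ((ih _).trans ?_) (hp j)
            gcongr
            exact hVmono (by linarith [ha j])
        _ = c * V (u - m) := by rw [← Finset.sum_mul, hp1, one_mul]
    have h2 : |φ u| + c * V (u - m) ≤ c * V u := by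
      by_cases hu : u ∈ Set.Icc α β
      · have h3 : 1 + V (u - m) ≤ V u := by
          have e1 : V u = (u - α) / m + 1 := by
            simp only [hV, min_eq_left hu.2]
            exact max_eq_right (by have := sub_nonneg.2 hu.1; positivity)
          have e2 : V (u - m) ≤ (u - α) / m := by
            refine max_le (by have := sub_nonneg.2 hu.1; positivity) ?_
            rw [min_eq_left (by linarith [hu.2])]
            field_simp
            linarith
          linarith
        nlinarith [hc u]
      · rw [hφ u hu, abs_zero, zero_add]
        gcongr
        exact hVmono (by linarith)
    exact (abs_add_le _ _).trans ((add_le_add_right h1 _).trans h2)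

/-- Existence of a bounded, uniformly continuous solution of the renewal equation. -/
lemma exists_renewal_solution (hp : ∀ j, 0 ≤ p j) (hp1 : ∑ j, p j = 1) (hm : 0 < m)
    (ha : ∀ j, m ≤ a j) {f : ℝ → ℝ} {α β : ℝ} (hαβ : α ≤ β) (hf : Continuous f)
    (hf0 : ∀ x, 0 ≤ f x) (hsupp : ∀ x, x ∉ Set.Icc α β → f x = 0) :
    ∃ h : ℝ → ℝ, UniformContinuous h ∧ (∀ u, 0 ≤ h u) ∧ (∃ B, ∀ u, h u ≤ B) ∧
      (∀ u < α, h u = 0) ∧ ∀ u, h u = f u + ∑ j, p j * h (u - a j) := by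
  have hcs : HasCompactSupport f := HasCompactSupport.intro isCompact_Icc hsupp
  obtain ⟨C, hC⟩ := hf.bounded_above_of_compact_support hcs
  have hCb : ∀ x, |f x| ≤ C := hC
  have hbdd : ∀ u, BddAbove (Set.range fun N => renewalSum p a f N u) := fun u =>
    ⟨C * ((β - α) / m + 1), by
      rintro _ ⟨N, rfl⟩
      exact (le_abs_self _).trans (abs_renewalSum_le hp hp1 hm ha hαβ hCb hsupp N u)⟩
  have hlim : ∀ u, Tendsto (fun N => renewalSum p a f N u) atTop
      (𝓝 (⨆ N, renewalSum p a f N u)) := fun u =>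
    tendsto_atTop_ciSup (monotone_nat_of_le_succ fun N => renewalSum_le_succ hp hf0 N u) (hbdd u)
  set h : ℝ → ℝ := fun u => ⨆ N, renewalSum p a f N u with hh
  refine ⟨h, ?_, fun u => ge_of_tendsto' (hlim u) fun N => renewalSum_nonneg hp hf0 N u,
    ⟨C * ((β - α) / m + 1), fun u => le_of_tendsto' (hlim u) fun N =>
      (le_abs_self _).trans (abs_renewalSum_le hp hp1 hm ha hαβ hCb hsupp N u)⟩,
    fun u hu => tendsto_nhds_unique (hlim u) ?_, fun u => ?_⟩
  · have huc : UniformContinuous f := hcs.uniformContinuous_of_continuous hf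
    rw [Metric.uniformContinuous_iff] at huc ⊢
    intro ε hε
    -- The difference of two translates of the series is the series of `f (· + (x - y)) - f`. That
    -- source is uniformly small and, as `|x - y| < 1`, supported in `[α - 1, β + 1]`, so the
    -- uniform bound applies with constant `K`.
    set K : ℝ := (β + 1 - (α - 1)) / m + 1 with hK
    have hKpos : 0 < K := by
      have : 0 < β + 1 - (α - 1) := by linarith
      positivity
    obtain ⟨δ, hδ, H⟩ := huc (ε / (2 * K)) (by positivity)
    refine ⟨min δ 1, by positivity, fun {x y} hxy => ?_⟩
    have hd : |x - y| < min δ 1 := hxy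
    have hdδ := hd.trans_le (min_le_left _ _)
    have hd1 := abs_lt.1 (hd.trans_le (min_le_right _ _))
    have key : ∀ N, |renewalSum p a f N x - renewalSum p a f N y| ≤ ε / (2 * K) * K := by
      intro N
      have e : renewalSum p a f N x - renewalSum p a f N y
          = renewalSum p a (fun t => f (t + (x - y)) + -f t) N y := by
        rw [renewalSum_add (fun t => f (t + (x - y))) (fun t => -f t), renewalSum_neg,
          renewalSum_translate f]
        simp [sub_eq_add_neg]
      rw [e]
      refine abs_renewalSum_le hp hp1 hm ha (by linarith) (fun t => ?_) (fun t ht => ?_) N y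
      · have := H (a := t + (x - y)) (b := t) (by simpa [Real.dist_eq] using hdδ)
        rw [Real.dist_eq] at this
        exact this.le
      · rw [hsupp t fun h' => ht ⟨by linarith [h'.1], by linarith [h'.2]⟩,
          hsupp _ fun h' => ht ⟨by linarith [h'.1], by linarith [h'.2]⟩]
        simp
    have hle : |h x - h y| ≤ ε / (2 * K) * K :=
      le_of_tendsto' ((hlim x).sub (hlim y)).abs key
    rw [Real.dist_eq]
    refine hle.trans_lt ?_
    field_simp
    linarith
  · simp only [renewalSum_eq_zero (fun j => hm.le.trans (ha j))
      (fun x hx => hsupp x fun h' => absurd h'.1 (not_le.2 hx)) _ hu]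
    exact tendsto_const_nhds
  · refine tendsto_nhds_unique ((tendsto_add_atTop_iff_nat 1).2 (hlim u)) ?_
    exact tendsto_const_nhds.add (tendsto_finsetSum _ fun j _ => (hlim _).const_mul _)

/-- The conservation law of the renewal equation. -/
lemma renewal_conservation (hp1 : ∑ j, p j = 1) (ha : ∀ j, 0 ≤ a j) {f h : ℝ → ℝ} {α : ℝ}
    (hf : Continuous f) (hh : Continuous h) (h0 : ∀ u < α, h u = 0)
    (heq : ∀ u, h u = f u + ∑ j, p j * h (u - a j)) (u : ℝ) :
    ∑ j, p j * ∫ t in (u - a j)..u, h t = ∫ t in α..u, f t := by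
  have hi : ∀ x y, IntervalIntegrable h volume x y := fun x y => hh.intervalIntegrable x y
  have h1 : ∫ t in α..u, h t = (∫ t in α..u, f t) + ∑ j, p j * ∫ t in α..(u - a j), h t := by
    conv_lhs => rw [funext heq]
    rw [intervalIntegral.integral_add (hf.intervalIntegrable _ _)
      (by apply Continuous.intervalIntegrable; fun_prop), intervalIntegral.integral_finsetSum
      (fun j _ => by apply Continuous.intervalIntegrable; fun_prop)]
    congr 1
    refine Finset.sum_congr rfl fun j _ => ?_
    rw [intervalIntegral.integral_const_mul, intervalIntegral.integral_comp_sub_right (fun t => h t),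
      ← intervalIntegral.integral_add_adjacent_intervals (hi (α - a j) α) (hi α (u - a j))]
    have : ∫ t in (α - a j)..α, h t = 0 := by
      rw [intervalIntegral.integral_of_le (by linarith [ha j]), integral_Ioc_eq_integral_Ioo]
      exact setIntegral_eq_zero_of_forall_eq_zero fun t ht => h0 t ht.2
    rw [this, zero_add]
  have h2 : ∀ j, ∫ t in (u - a j)..u, h t = (∫ t in α..u, h t) - ∫ t in α..(u - a j), h t :=
    fun j => (intervalIntegral.integral_interval_sub_left (hi _ _) (hi _ _)).symm
  simp only [h2, mul_sub, Finset.sum_sub_distrib, ← Finset.sum_mul, hp1, one_mul]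
  linarith

/-! ### Upper bound in the key renewal theorem. -/

/-- Where a bounded solution of the renewal equation is close to its upper limit, it also is after
a step back. -/
lemma tendsto_comp_sub_of_tendsto_limsup (hp : ∀ j, 0 < p j) (hp1 : ∑ j, p j = 1)
    {f h : ℝ → ℝ} {β M : ℝ} (hf : ∀ u, β < u → f u = 0)
    (heq : ∀ u, h u = f u + ∑ j, p j * h (u - a j))
    (hM : ∀ ε > 0, ∀ᶠ u in atTop, h u < M + ε) {L : Filter ℝ} (hL : L ≤ atTop) {w : ℝ}
    (hw : Tendsto (fun u => h (u - w)) L (𝓝 M)) (j : ι) :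
    Tendsto (fun u => h (u - (w + a j))) L (𝓝 M) := by
  classical
  have hshift : ∀ c : ℝ, Tendsto (fun u : ℝ => u - c) L atTop := fun c =>
    (tendsto_atTop_add_const_right atTop (-c) tendsto_id).mono_left hL
  rw [tendsto_order]
  refine ⟨fun b hb => ?_, fun b hb => ?_⟩
  · have hη : 0 < p j * (M - b) / 2 := by have := hp j; have := sub_pos.2 hb; positivity
    set η := p j * (M - b) / 2 with hηdef
    filter_upwards [(hshift w).eventually (eventually_gt_atTop β),
      hw.eventually (lt_mem_nhds (show M - η < M by linarith)),
      eventually_all.2 fun i => (hshift (w + a i)).eventually (hM η hη)] with u hu1 hu2 hu3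
    have e := heq (u - w)
    rw [hf _ hu1, zero_add, ← Finset.add_sum_erase _ _ (Finset.mem_univ j)] at e
    have hle : ∑ i ∈ Finset.univ.erase j, p i * h (u - w - a i) ≤
        ∑ i ∈ Finset.univ.erase j, p i * (M + η) := by
      gcongr with i
      · exact (hp i).le
      · rw [sub_sub]; exact (hu3 i).le
    have hs : ∑ i ∈ Finset.univ.erase j, p i * (M + η) = (1 - p j) * (M + η) := by
      rw [← Finset.sum_mul, ← hp1, ← Finset.add_sum_erase _ _ (Finset.mem_univ j)]
      ring
    rw [sub_sub] at e
    have : p j * b < p j * h (u - (w + a j)) := by nlinarith [hp j]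
    exact lt_of_mul_lt_mul_left this (hp j).le
  · filter_upwards [(hshift (w + a j)).eventually (hM (b - M) (by linarith))] with u hu
    linarith

lemma tendsto_comp_sub_nsmul (hp : ∀ j, 0 < p j) (hp1 : ∑ j, p j = 1)
    {f h : ℝ → ℝ} {β M : ℝ} (hf : ∀ u, β < u → f u = 0)
    (heq : ∀ u, h u = f u + ∑ j, p j * h (u - a j))
    (hM : ∀ ε > 0, ∀ᶠ u in atTop, h u < M + ε) {L : Filter ℝ} (hL : L ≤ atTop)
    (hLM : Tendsto h L (𝓝 M)) (j l : ι) (m n : ℕ) :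
    Tendsto (fun u => h (u - (m * a j + n * a l))) L (𝓝 M) := by
  induction m with
  | zero =>
    induction n with
    | zero => simpa using hLM
    | succ n ih =>
      convert tendsto_comp_sub_of_tendsto_limsup hp hp1 hf heq hM hL ih l using 4
      push_cast; ring
  | succ m ih =>
    convert tendsto_comp_sub_of_tendsto_limsup hp hp1 hf heq hM hL ih j using 4
    push_cast; ring

/-- The additive semigroup generated by two incommensurable numbers meets every
`δ`-neighbourhood of the points of a suitable interval of length `A`, using finitely many
elements. -/
lemma exists_finite_net_of_irrational {x y : ℝ} (hxy : Irrational (x / y)) {A δ : ℝ}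
    (hδ : 0 < δ) :
    ∃ (T : ℝ) (W : Finset (ℕ × ℕ)), ∀ t ∈ Set.Icc T (T + A), ∃ w ∈ W,
      |t - (w.1 * x + w.2 * y)| < δ := by
  classical
  have hd : Dense (AddSubgroup.closure {x, y} : Set ℝ) := dense_addSubgroupClosure_pair_iff.2 hxy
  obtain ⟨t, ht, hcov⟩ := (isCompact_Icc (a := (0 : ℝ)) (b := A)).elim_finite_subcover_image
    (b := Set.univ) (c := fun w : ℤ × ℤ => Metric.ball (w.1 * x + w.2 * y) δ)
    (fun _ _ => Metric.isOpen_ball) (fun s _ => by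
      obtain ⟨z, hz, hzs⟩ := Metric.dense_iff.1 hd s δ hδ
      obtain ⟨i, k, rfl⟩ := AddSubgroup.mem_closure_pair.1 hzs
      simp only [Set.mem_iUnion]
      exact ⟨(i, k), Set.mem_univ _, by simpa [dist_comm] using hz⟩)
  obtain ⟨htf, hcov⟩ := hcov
  -- Density of the group yields finitely many integer pairs; adding `K` to all coefficients makes
  -- them natural numbers and shifts the window by `T = K * x + K * y`.
  obtain ⟨K, hK⟩ : ∃ K : ℕ, ∀ w ∈ htf.toFinset, 0 ≤ w.1 + K ∧ 0 ≤ w.2 + K := by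
    refine ⟨htf.toFinset.sup fun w => max w.1.natAbs w.2.natAbs, fun w hw => ?_⟩
    have := Finset.le_sup (f := fun w : ℤ × ℤ => max w.1.natAbs w.2.natAbs) hw
    omega
  refine ⟨K * x + K * y, htf.toFinset.image fun w : ℤ × ℤ => ((w.1 + K).toNat, (w.2 + K).toNat),
    fun s hs => ?_⟩
  have := hcov (show s - (K * x + K * y) ∈ Set.Icc 0 A from
    ⟨by linarith [hs.1], by linarith [hs.2]⟩)
  simp only [Set.mem_iUnion] at this
  obtain ⟨w, hw, hws⟩ := this
  have hw' := htf.mem_toFinset.2 hw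
  refine ⟨_, Finset.mem_image_of_mem _ hw', ?_⟩
  have e1 : (((w.1 + K).toNat : ℕ) : ℝ) = w.1 + K := by
    have := Int.toNat_of_nonneg (hK w hw').1
    exact_mod_cast congrArg (Int.cast (R := ℝ)) this
  have e2 : (((w.2 + K).toNat : ℕ) : ℝ) = w.2 + K := by
    have := Int.toNat_of_nonneg (hK w hw').2
    exact_mod_cast congrArg (Int.cast (R := ℝ)) this
  simp only [e1, e2]
  rw [Metric.mem_ball, Real.dist_eq] at hws
  convert hws using 2
  ring

/-- Upper bound in the key renewal theorem, for finitely many incommensurable steps. -/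
lemma renewal_limsup_le (hp : ∀ j, 0 < p j) (hp1 : ∑ j, p j = 1) (ha : ∀ j, 0 < a j)
    {j₀ l₀ : ι} (hirr : Irrational (a j₀ / a l₀)) {f h : ℝ → ℝ} {α β : ℝ}
    (hf : Continuous f) (hsupp : ∀ x, x ∉ Set.Icc α β → f x = 0) (hh : UniformContinuous h)
    (hB : ∃ B, ∀ u, h u ≤ B) (hh0 : ∀ u, 0 ≤ h u)
    (h0 : ∀ u < α, h u = 0) (heq : ∀ u, h u = f u + ∑ j, p j * h (u - a j))
    {ε : ℝ} (hε : 0 < ε) :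
    ∀ᶠ u in atTop, h u < (∫ t in α..β, f t) / (∑ j, p j * a j) + ε := by
  obtain ⟨B, hB⟩ := hB
  have hbdd : IsBoundedUnder (· ≤ ·) atTop h := isBoundedUnder_of ⟨B, hB⟩
  have hbdd' : IsBoundedUnder (· ≥ ·) atTop h := isBoundedUnder_of ⟨0, hh0⟩
  set M := limsup h atTop with hMdef
  have hM : ∀ ε > 0, ∀ᶠ u in atTop, h u < M + ε := fun ε hε =>
    eventually_lt_of_limsup_lt (by linarith) hbdd
  have hcl : MapClusterPt M atTop h := MapClusterPt.limsup hbdd'.isCoboundedUnder_flip hbdd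
  have habar : 0 < ∑ j, p j * a j :=
    Finset.sum_pos (fun j _ => mul_pos (hp j) (ha j)) ⟨j₀, Finset.mem_univ _⟩
  -- `L` plays the role of a sequence tending to infinity along which `h` tends to its upper limit.
  set L : Filter ℝ := atTop ⊓ comap h (𝓝 M) with hLdef
  have hLne : L.NeBot := by
    rw [← map_neBot_iff h, hLdef, Filter.push_pull, inf_comm]
    exact hcl
  have hL : L ≤ atTop := inf_le_left
  have hLM : Tendsto h L (𝓝 M) := tendsto_comap.mono_left inf_le_right
  suffices H : M ≤ (∫ t in α..β, f t) / ∑ j, p j * a j by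
    filter_upwards [hM ε hε] with u hu
    linarith
  refine le_of_forall_pos_le_add fun η hη => ?_
  obtain ⟨δ, hδ, huc⟩ := Metric.uniformContinuous_iff.1 hh (η / 2) (by positivity)
  set A := ∑ j, a j with hA
  have haA : ∀ j, a j ≤ A := fun j =>
    Finset.single_le_sum (f := a) (fun i _ => (ha i).le) (Finset.mem_univ j)
  obtain ⟨T, W, hW⟩ := exists_finite_net_of_irrational (A := A) hirr hδ
  have hev : ∀ᶠ u in L, ∀ w ∈ W, M - η / 2 < h (u - (w.1 * a j₀ + w.2 * a l₀)) := by
    rw [eventually_all_finset]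
    intro w _
    exact (tendsto_comp_sub_nsmul hp hp1
      (fun u hu => hsupp u fun h' => absurd h'.2 (not_le.2 hu)) heq hM hL hLM j₀ l₀ w.1
      w.2).eventually (lt_mem_nhds (by linarith))
  -- One `u` suffices: `h` is near `M` on a net of a window of length `A`, hence on the whole window
  -- by uniform continuity. That window contains every `[u - T - a j, u - T]`, and `u - T ≥ β` puts
  -- the full mass of `f` into the conservation law.
  obtain ⟨u, hu, huβ⟩ := (hev.and (hL (eventually_ge_atTop (β + T)))).exists
  have hlow : ∀ t ∈ Set.Icc (u - T - A) (u - T), M - η ≤ h t := by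
    intro t ht
    obtain ⟨w, hw, hwt⟩ := hW (u - t) ⟨by linarith [ht.2], by linarith [ht.1]⟩
    have h1 := hu w hw
    have h2 := huc (a := t) (b := u - (w.1 * a j₀ + w.2 * a l₀)) (by
      rw [Real.dist_eq, abs_sub_comm]
      convert hwt using 2
      ring)
    rw [Real.dist_eq, abs_lt] at h2
    linarith
  have hcons := renewal_conservation hp1 (fun j => (ha j).le) hf hh.continuous h0 heq (u - T)
  have hfint : ∫ t in α..(u - T), f t = ∫ t in α..β, f t := by
    rw [← intervalIntegral.integral_add_adjacent_intervals (hf.intervalIntegrable α β)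
      (hf.intervalIntegrable β (u - T)), add_eq_left,
      intervalIntegral.integral_of_le (by linarith)]
    exact setIntegral_eq_zero_of_forall_eq_zero fun t ht =>
      hsupp t fun h' => absurd h'.2 (not_le.2 ht.1)
  have hge : (M - η) * ∑ j, p j * a j ≤ ∑ j, p j * ∫ t in (u - T - a j)..(u - T), h t := by
    rw [Finset.mul_sum]
    refine Finset.sum_le_sum fun j _ => ?_
    have : ∫ _ in (u - T - a j)..(u - T), (M - η) ≤ ∫ t in (u - T - a j)..(u - T), h t :=
      intervalIntegral.integral_mono_on (by linarith [ha j]) (by simp)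
        (hh.continuous.intervalIntegrable _ _)
        fun t ht => hlow t ⟨by linarith [ht.1, haA j], ht.2⟩
    rw [intervalIntegral.integral_const, sub_sub_cancel, smul_eq_mul] at this
    nlinarith [hp j]
  rw [hcons, hfint] at hge
  rw [← sub_le_iff_le_add, le_div_iff₀ habar]
  exact hge

/-- A nonnegative subsolution `g ≤ P g` is controlled at infinity by its integral over any
interval longer than all steps. -/
lemma eventually_lt_of_le_average (hp : ∀ j, 0 < p j) (hp1 : ∑ j, p j = 1) (ha : ∀ j, 0 < a j)
    {j₀ l₀ : ι} (hirr : Irrational (a j₀ / a l₀)) {g : ℝ → ℝ} (hg : Continuous g)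
    (hg0 : ∀ u, 0 ≤ g u) (hsub : ∀ u, g u ≤ ∑ j, p j * g (u - a j)) (s : ℝ)
    {ε : ℝ} (hε : 0 < ε) :
    ∀ᶠ u in atTop,
      g u < (∫ t in (s - ∑ j, a j - 1)..(s + 1), g t) / (∑ j, p j * a j) + ε := by
  classical
  have : Nonempty ι := ⟨j₀⟩
  set A := ∑ j, a j with hA
  have haA : ∀ j, a j ≤ A := fun j =>
    Finset.single_le_sum (f := a) (fun i _ => (ha i).le) (Finset.mem_univ j)
  have hA0 : 0 ≤ A := (ha j₀).le.trans (haA j₀)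
  obtain ⟨i, hi⟩ := Finite.exists_min a
  have habar : 0 < ∑ j, p j * a j :=
    Finset.sum_pos (fun j _ => mul_pos (hp j) (ha j)) ⟨j₀, Finset.mem_univ _⟩
  -- Trapezoidal cutoff: `1` on `[s - A, s]`, `0` outside `[s - A - 1, s + 1]`.
  set χ : ℝ → ℝ := fun u => max 0 (min 1 (min (u - (s - A - 1)) (s + 1 - u))) with hχ
  have hχ0 : ∀ u, 0 ≤ χ u := fun u => le_max_left _ _
  have hχ1 : ∀ u, χ u ≤ 1 := fun u => max_le zero_le_one (min_le_left _ _)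
  have hχin : ∀ u ∈ Set.Icc (s - A) s, χ u = 1 := fun u hu => by
    simp only [hχ]
    rw [min_eq_left (le_min (by linarith [hu.1]) (by linarith [hu.2])), max_eq_right zero_le_one]
  have hχout : ∀ u, u ∉ Set.Icc (s - A - 1) (s + 1) → χ u = 0 := fun u hu => by
    refine max_eq_left ((min_le_right _ _).trans ?_)
    by_contra! hcon
    obtain ⟨h1, h2⟩ := lt_min_iff.1 hcon
    exact hu ⟨by linarith, by linarith⟩
  set f : ℝ → ℝ := fun u => χ u * g u with hfdef
  have hf : Continuous f := by simp only [hfdef, hχ]; fun_prop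
  have hf0 : ∀ u, 0 ≤ f u := fun u => mul_nonneg (hχ0 u) (hg0 u)
  have hsupp : ∀ u, u ∉ Set.Icc (s - A - 1) (s + 1) → f u = 0 := fun u hu => by
    simp [hfdef, hχout u hu]
  obtain ⟨h, huc, hh0, hB, hz, heq⟩ := exists_renewal_solution (fun j => (hp j).le) hp1 (ha i) hi
    (by linarith) hf hf0 hsupp
  -- Induction by the smallest step `a i`. Up to `s` the source already equals `g`; beyond `s`, a
  -- step back is at least `a i`, so it reaches the previous range, and at most `A`, so it stays
  -- right of `s - A`.
  have hgh : ∀ n : ℕ, ∀ u ∈ Set.Icc (s - A) (s + n * a i), g u ≤ h u := by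
    intro n
    induction n with
    | zero =>
      intro u hu
      rw [heq u]
      have : f u = g u := by simp [hfdef, hχin u (by simpa using hu)]
      rw [this, le_add_iff_nonneg_right]
      exact Finset.sum_nonneg fun j _ => mul_nonneg (hp j).le (hh0 _)
    | succ n ih =>
      intro u hu
      by_cases hus : u ≤ s
      · exact ih u ⟨hu.1, hus.trans (by have := ha i; simp; positivity)⟩
      · have hu2 := hu.2
        push_cast at hu2
        refine (hsub u).trans (le_trans ?_ (heq u).ge)
        refine le_trans ?_ (le_add_of_nonneg_left (hf0 u))
        gcongr with j
        · exact (hp j).le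
        · exact ih _ ⟨by linarith [haA j], by linarith [hi j]⟩
  have hint : ∫ t in (s - A - 1)..(s + 1), f t ≤ ∫ t in (s - A - 1)..(s + 1), g t :=
    intervalIntegral.integral_mono_on (by linarith) (hf.intervalIntegrable _ _)
      (hg.intervalIntegrable _ _) fun t _ => mul_le_of_le_one_left (hg0 t) (hχ1 t)
  filter_upwards [renewal_limsup_le hp hp1 ha hirr hf hsupp huc hB hh0 hz heq hε,
    eventually_ge_atTop s] with u hu hus
  obtain ⟨n, hn⟩ := exists_nat_ge ((u - s) / a i)
  have hn' : u - s ≤ n * a i := (div_le_iff₀ (ha i)).1 hn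
  refine (hgh n u ⟨by linarith, by linarith⟩).trans_lt (hu.trans_le ?_)
  gcongr

end Renewal

/-! ### Wiener's lemma and logarithmic windows. -/

/-- Wiener's lemma for measures without atoms. -/
lemma tendsto_average_sq_norm_charFun (μ : Measure ℝ) [IsProbabilityMeasure μ]
    [NullSingletonClass μ] :
    Tendsto (fun r : ℝ => (2 * r)⁻¹ * ∫ t in -r..r, ‖charFun μ t‖ ^ 2) atTop (𝓝 0) := by
  -- The convolution of `μ` with its reflection has characteristic function `‖charFun μ t‖ ^ 2` and
  -- no mass at `0`; its averages over `[-r, r]` are `∫ sinc (r * x) ∂ν`, which tend to `ν {0}`.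
  set ν : Measure ℝ := μ ∗ μ.map (fun x => (-1) * x) with hν
  have : IsProbabilityMeasure (μ.map fun x : ℝ => (-1) * x) :=
    Measure.isProbabilityMeasure_map (by fun_prop)
  have hchar : ∀ t, charFun ν t = ((‖charFun μ t‖ ^ 2 : ℝ) : ℂ) := fun t => by
    rw [hν, charFun_conv, charFun_map_mul, neg_one_mul, charFun_neg, Complex.mul_conj,
      Complex.normSq_eq_norm_sq]
  have hν0 : ν {0} = 0 := by
    rw [hν, Measure.conv, Measure.map_apply (by fun_prop) (measurableSet_singleton 0),
      Measure.measure_prod_null (measurableSet_singleton (0 : ℝ) |>.preimage (by fun_prop))]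
    refine Eventually.of_forall fun x => ?_
    change μ.map (fun x : ℝ => (-1) * x) (Prod.mk x ⁻¹' ((fun x : ℝ × ℝ => x.1 + x.2) ⁻¹' {0})) = 0
    rw [Measure.map_apply (by fun_prop)
      ((measurableSet_singleton (0 : ℝ) |>.preimage (by fun_prop)).preimage (by fun_prop))]
    refine measure_mono_null (t := {x}) (fun y hy => ?_) (measure_singleton x)
    simp only [Set.mem_preimage, Set.mem_singleton_iff] at hy ⊢
    linarith
  have hsinc : Tendsto (fun r : ℝ => ∫ x, Real.sinc (r * x) ∂ν) atTop (𝓝 0) := by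
    rw [← integral_zero ℝ ℝ (μ := ν)]
    refine tendsto_integral_filter_of_dominated_convergence (fun _ => 1)
      (Eventually.of_forall fun r =>
        (Real.continuous_sinc.comp (continuous_const_mul r)).aestronglyMeasurable)
      (Eventually.of_forall fun r => Eventually.of_forall fun x => Real.abs_sinc_le_one _)
      (integrable_const _) ?_
    have hae : ∀ᵐ x ∂ν, x ≠ 0 := by
      rw [ae_iff]; simpa using hν0
    filter_upwards [hae] with x hx
    refine squeeze_zero_norm' ?_ (tendsto_inv_atTop_zero.comp
      (tendsto_id.atTop_mul_const (abs_pos.2 hx)))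
    filter_upwards [eventually_gt_atTop 0] with r hr
    rw [Real.norm_eq_abs, Real.sinc_of_ne_zero (mul_ne_zero hr.ne' hx), abs_div, abs_mul,
      abs_of_pos hr, Function.comp_apply, id, ← one_div]
    gcongr
    exact Real.abs_sin_le_one _
  refine hsinc.congr' ?_
  filter_upwards [eventually_gt_atTop 0] with r hr
  have h := integral_charFun_Icc (μ := ν) hr
  simp only [hchar] at h
  rw [intervalIntegral.integral_ofReal] at h
  norm_cast at h
  rw [h]
  field_simp

/-- Logarithmic averages over windows of fixed length of the squared characteristic function of a
measure without atoms tend to zero. -/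
lemma tendsto_integral_sq_norm_charFun_exp (μ : Measure ℝ) [IsProbabilityMeasure μ]
    [NullSingletonClass μ]
    {c d : ℝ} (hcd : c ≤ d) :
    Tendsto (fun s : ℝ => ∫ u in (s + c)..(s + d), ‖charFun μ (Real.exp u)‖ ^ 2) atTop (𝓝 0) := by
  have hcont : Continuous fun t => ‖charFun μ t‖ ^ 2 := continuous_charFun.norm.pow 2
  -- The average is taken with radius `exp (s + d)`. Substituting `t = exp u` costs at most `exp
  -- (-(s + c))`, which is `2 * exp (d - c)` times the normalisation `(2 * exp (s + d))⁻¹`.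
  have h := ((tendsto_average_sq_norm_charFun μ).comp (Real.tendsto_exp_atTop.comp
    (tendsto_atTop_add_const_right atTop d tendsto_id))).const_mul (2 * Real.exp (d - c))
  rw [mul_zero] at h
  refine squeeze_zero (fun s => intervalIntegral.integral_nonneg (by linarith)
    fun u _ => by positivity) (fun s => ?_) h
  have h1 : ∫ u in (s + c)..(s + d), ‖charFun μ (Real.exp u)‖ ^ 2 ≤
      ∫ u in (s + c)..(s + d),
        Real.exp (-(s + c)) * (‖charFun μ (Real.exp u)‖ ^ 2 * Real.exp u) := by
    have hc2 : Continuous fun u => ‖charFun μ (Real.exp u)‖ ^ 2 := hcont.comp Real.continuous_exp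
    refine intervalIntegral.integral_mono_on (by linarith) (hc2.intervalIntegrable _ _)
      (Continuous.intervalIntegrable (by fun_prop) _ _) fun u hu => ?_
    have : 1 ≤ Real.exp (-(s + c)) * Real.exp u := by
      rw [← Real.exp_add]; exact Real.one_le_exp (by linarith [hu.1])
    nlinarith [sq_nonneg ‖charFun μ (Real.exp u)‖]
  have h2 : ∫ u in (s + c)..(s + d), ‖charFun μ (Real.exp u)‖ ^ 2 * Real.exp u =
      ∫ t in Real.exp (s + c)..Real.exp (s + d), ‖charFun μ t‖ ^ 2 :=
    intervalIntegral.integral_comp_mul_deriv (g := fun t => ‖charFun μ t‖ ^ 2)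
      (fun u _ => Real.hasDerivAt_exp u) Real.continuous_exp.continuousOn hcont
  have h3 : ∫ t in Real.exp (s + c)..Real.exp (s + d), ‖charFun μ t‖ ^ 2 ≤
      ∫ t in -Real.exp (s + d)..Real.exp (s + d), ‖charFun μ t‖ ^ 2 := by
    refine intervalIntegral.integral_mono_interval
      (by linarith [Real.exp_pos (s + c), Real.exp_pos (s + d)])
      (Real.exp_le_exp.2 (by linarith)) le_rfl
      (Eventually.of_forall fun t => by positivity) (hcont.intervalIntegrable _ _)
  rw [intervalIntegral.integral_const_mul, h2] at h1
  refine (h1.trans (mul_le_mul_of_nonneg_left h3 (Real.exp_pos _).le)).trans_eq ?_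
  simp only [Function.comp_apply, id]
  rw [mul_inv, ← Real.exp_neg, show -(s + c) = (d - c) + -(s + d) by ring, Real.exp_add]
  ring

/-! ### Self-similar sets and measures. -/

section SelfSimilar

variable {ι : Type*} [Fintype ι] {r b p : ι → ℝ} {μ : Measure ℝ}

lemma continuous_similitude (r b : ℝ) : Continuous (similitude r b) := by
  unfold similitude; fun_prop

lemma charFun_map_similitude (μ : Measure ℝ) (r b t : ℝ) :
    charFun (μ.map (similitude r b)) t = Complex.exp (t * b * Complex.I) * charFun μ (r * t) := by
  rw [charFun_apply_real, charFun_apply_real,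
    integral_map (continuous_similitude r b).aemeasurable (by fun_prop), ← integral_const_mul]
  refine integral_congr_ae (Eventually.of_forall fun x => ?_)
  simp only [similitude]
  rw [← Complex.exp_add]
  push_cast
  ring_nf

lemma charFun_selfSimilar [IsProbabilityMeasure μ] (hp : ∀ j, 0 ≤ p j)
    (hμ : μ = ∑ j, ENNReal.ofReal (p j) • μ.map (similitude (r j) (b j))) (t : ℝ) :
    charFun μ t = ∑ j, (p j : ℂ) * (Complex.exp (t * b j * Complex.I) * charFun μ (r j * t)) := by
  have hpm : ∀ j, IsProbabilityMeasure (μ.map (similitude (r j) (b j))) := fun j =>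
    Measure.isProbabilityMeasure_map (continuous_similitude _ _).aemeasurable
  conv_lhs => rw [hμ, charFun_apply_real]
  rw [integral_finsetSum_measure]
  · refine Finset.sum_congr rfl fun j _ => ?_
    rw [integral_smul_measure, ← charFun_apply_real, charFun_map_similitude,
      ENNReal.toReal_ofReal (hp j), Complex.real_smul]
  · intro j _
    refine Integrable.smul_measure ?_ ENNReal.ofReal_ne_top
    refine Integrable.of_bound (C := 1) (by fun_prop) (Eventually.of_forall fun x => ?_)
    rw [← Complex.ofReal_mul, Complex.norm_exp_ofReal_mul_I]

/-- The triangle inequality removes the phases, and convexity of the square passes to the quantity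
that Wiener's lemma controls. -/
lemma sq_norm_charFun_selfSimilar_le [IsProbabilityMeasure μ] (hp : ∀ j, 0 ≤ p j)
    (hp1 : ∑ j, p j = 1)
    (hμ : μ = ∑ j, ENNReal.ofReal (p j) • μ.map (similitude (r j) (b j))) (t : ℝ) :
    ‖charFun μ t‖ ^ 2 ≤ ∑ j, p j * ‖charFun μ (r j * t)‖ ^ 2 := by
  have h1 : ‖charFun μ t‖ ≤ ∑ j, p j * ‖charFun μ (r j * t)‖ := by
    rw [charFun_selfSimilar hp hμ t]
    refine (norm_sum_le _ _).trans (Finset.sum_le_sum fun j _ => ?_)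
    rw [norm_mul, norm_mul, Complex.norm_real, Real.norm_of_nonneg (hp j), ← Complex.ofReal_mul,
      Complex.norm_exp_ofReal_mul_I, one_mul]
  calc _ ≤ (∑ j, p j * ‖charFun μ (r j * t)‖) ^ 2 := by gcongr
    _ ≤ _ := Real.pow_arith_mean_le_arith_mean_pow _ _ _ (fun j _ => hp j) hp1
      (fun j _ => norm_nonneg _) 2

/-- A self-similar set with more than one point has no common fixed point of its maps. -/
lemma IsSelfSimilarSet.not_forall_fixed {F : Set ℝ} (hF : IsSelfSimilarSet r b F)
    (hsing : ¬ ∃ x : ℝ, F = {x}) (c : ℝ) : ¬ ∀ j, similitude (r j) (b j) c = c := by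
  intro hc
  obtain ⟨x₀, hx₀⟩ := hF.nonempty
  have hne : Nonempty ι := by
    have h := hx₀
    rw [hF.eq_iUnion, Set.mem_iUnion] at h
    exact ⟨h.choose⟩
  obtain ⟨i, hi⟩ := Finite.exists_max r
  -- Around a common fixed point every map contracts by at most the largest ratio `r i`, and each
  -- point of `F` has preimages in `F` of every order.
  have key : ∀ n : ℕ, ∀ x ∈ F, |x - c| ≤ r i ^ n * (1 + |c|) := by
    intro n
    induction n with
    | zero =>
      intro x hx
      have := hF.subset_unit hx
      rw [pow_zero, one_mul]
      refine (abs_sub x c).trans ?_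
      rw [abs_of_nonneg this.1]
      linarith [this.2]
    | succ n ih =>
      intro x hx
      rw [hF.eq_iUnion, Set.mem_iUnion] at hx
      obtain ⟨j, y, hy, rfl⟩ := hx
      have e : similitude (r j) (b j) y - c = r j * (y - c) := by
        have := hc j
        simp only [similitude] at this ⊢
        linear_combination this
      rw [e, abs_mul, abs_of_pos (hF.ratio_pos j), pow_succ', mul_assoc]
      exact mul_le_mul (hi j) (ih y hy) (abs_nonneg _) (hF.ratio_pos i).le
  have heq : ∀ x ∈ F, x = c := by
    intro x hx
    have hlim : Tendsto (fun n : ℕ => r i ^ n * (1 + |c|)) atTop (𝓝 (0 * (1 + |c|))) :=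
      (tendsto_pow_atTop_nhds_zero_of_lt_one (hF.ratio_pos i).le (hF.ratio_lt_one i)).mul_const _
    rw [zero_mul] at hlim
    have : |x - c| ≤ 0 := ge_of_tendsto' hlim fun n => key n x hx
    exact sub_eq_zero.1 (abs_nonpos_iff.1 this)
  exact hsing ⟨c, Set.eq_singleton_iff_nonempty_unique_mem.2 ⟨hF.nonempty, heq⟩⟩

/-- A self-similar measure whose maps have no common fixed point has no atoms. -/
lemma noAtoms_of_selfSimilar [IsProbabilityMeasure μ] (hr : ∀ j, 0 < r j ∧ r j < 1)
    (hp : ∀ j, 0 < p j) (hp1 : ∑ j, p j = 1)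
    (hμ : μ = ∑ j, ENNReal.ofReal (p j) • μ.map (similitude (r j) (b j)))
    (hfix : ∀ c, ¬ ∀ j, similitude (r j) (b j) c = c) : NullSingletonClass μ := by
  refine ⟨fun x₀ => ?_⟩
  by_contra hx₀
  have hfin : {x | μ {x₀} ≤ μ {x}}.Finite :=
    Measure.finite_const_le_meas_of_disjoint_iUnion μ (pos_iff_ne_zero.2 hx₀)
      (fun x => measurableSet_singleton x)
      (fun x y hxy => Set.disjoint_singleton.2 hxy) (measure_ne_top _ _)
  -- Only finitely many points have mass at least `μ {x₀}`, so a heaviest atom exists.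
  obtain ⟨x₁, hx₁, hmax⟩ := hfin.exists_maximalFor (fun x => μ.real {x}) _ ⟨x₀, le_refl (μ {x₀})⟩
  have hmax' : ∀ y, μ.real {y} ≤ μ.real {x₁} := by
    intro y
    by_contra! hy
    refine absurd (hmax (j := y) ?_ hy.le) (not_le.2 hy)
    refine le_trans (show μ {x₀} ≤ μ {x₁} from hx₁) ?_
    exact ((ENNReal.toReal_lt_toReal (measure_ne_top _ _) (measure_ne_top _ _)).1 hy).le
  set E := {x | μ.real {x} = μ.real {x₁}} with hE
  have hEfin : E.Finite := hfin.subset fun x hx => by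
    have : μ {x} = μ {x₁} :=
      (ENNReal.toReal_eq_toReal_iff' (measure_ne_top _ _) (measure_ne_top _ _)).1 hx
    exact (this ▸ hx₁ : μ {x₀} ≤ μ {x})
  have hpre : ∀ j x, similitude (r j) (b j) ⁻¹' {x} = {(x - b j) / r j} := by
    intro j x
    ext y
    have := (hr j).1
    simp only [similitude, Set.mem_preimage, Set.mem_singleton_iff]
    rw [eq_div_iff this.ne']
    constructor <;> intro h <;> linarith
  have hatom : ∀ x, μ.real {x} = ∑ j, p j * μ.real {(x - b j) / r j} := by
    intro x
    have h : μ {x} = ∑ j, ENNReal.ofReal (p j) * μ {(x - b j) / r j} := by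
      conv_lhs => rw [hμ]
      rw [Measure.finsetSum_apply]
      refine Finset.sum_congr rfl fun j _ => ?_
      rw [Measure.smul_apply, Measure.map_apply (continuous_similitude _ _).measurable
        (measurableSet_singleton x), hpre, smul_eq_mul]
    rw [measureReal_def, h, ENNReal.toReal_sum fun j _ =>
      ENNReal.mul_ne_top ENNReal.ofReal_ne_top (measure_ne_top _ _)]
    refine Finset.sum_congr rfl fun j _ => ?_
    rw [ENNReal.toReal_mul, ENNReal.toReal_ofReal (hp j).le, measureReal_def]
  -- The mass of `x` is the `p`-average of the masses of its preimages, so a maximal value forces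
  -- all of them to be maximal.
  have hback : ∀ j, ∀ x ∈ E, (x - b j) / r j ∈ E := by
    intro j x hx
    have h1 : ∑ i, p i * μ.real {(x - b i) / r i} = ∑ i, p i * μ.real {x₁} := by
      rw [← hatom, ← Finset.sum_mul, hp1, one_mul]; exact hx
    have h2 := (Finset.sum_eq_sum_iff_of_le fun i _ =>
      mul_le_mul_of_nonneg_left (hmax' ((x - b i) / r i)) (hp i).le).1 h1 j (Finset.mem_univ j)
    exact mul_left_cancel₀ (hp j).ne' h2
  refine hfix x₁ fun j => ?_
  have hrj := hr j
  -- `c` is the fixed point of the `j`-th map. The inverse map expands distances to `c` and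
  -- preserves the finite set `E`, so `E` contains only `c`, and `x₁ = c` for every `j`.
  set c := b j / (1 - r j) with hc
  have hcb : b j = (1 - r j) * c := by rw [hc]; field_simp [(by linarith : (1 - r j) ≠ 0)]
  obtain ⟨y, hy, hymax⟩ := hEfin.exists_maximalFor (fun x => |x - c|) _ ⟨x₁, rfl⟩
  have hy0 : |y - c| = 0 := by
    have e : (y - b j) / r j - c = (y - c) / r j := by
      rw [hcb]; field_simp [hrj.1.ne']; ring
    have h1 : |(y - c) / r j| ≤ |y - c| := by
      by_contra! hlt
      have := hymax (hback j y hy) (by simpa only [e] using hlt.le)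
      simp only [e] at this
      exact absurd this (not_le.2 hlt)
    rw [abs_div, abs_of_pos hrj.1, div_le_iff₀ hrj.1] at h1
    nlinarith [abs_nonneg (y - c)]
  have hx₁0 : |x₁ - c| = 0 := by
    refine le_antisymm ?_ (abs_nonneg _)
    by_contra! hlt
    have := hymax (j := x₁) rfl (by simp only [hy0]; exact hlt.le)
    simp only [hy0] at this
    linarith
  rw [abs_eq_zero, sub_eq_zero] at hx₁0
  rw [similitude, hx₁0, hcb]
  ring

end SelfSimilar

/-! ### Passage to the Fourier transform and conclusion. -/

lemma measureFourier_eq_charFun (μ : Measure ℝ) (ξ : ℝ) :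
    measureFourier μ ξ = charFun μ (-(2 * Real.pi * ξ)) := by
  rw [measureFourier, charFun_apply_real]
  congr 1
  ext x
  push_cast
  ring_nf

/-- Values at `t` and `-t` are conjugate, so decay at positive frequencies `exp u` is enough. -/
lemma isRajchman_of_tendsto_exp {μ : Measure ℝ}
    (h : Tendsto (fun u : ℝ => ‖charFun μ (Real.exp u)‖ ^ 2) atTop (𝓝 0)) : IsRajchman μ := by
  have h1 : Tendsto (fun t : ℝ => ‖charFun μ t‖) atTop (𝓝 0) := by
    have h2 : Tendsto (fun t : ℝ => ‖charFun μ t‖ ^ 2) atTop (𝓝 0) := by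
      refine (h.comp Real.tendsto_log_atTop).congr' ?_
      filter_upwards [eventually_gt_atTop 0] with t ht
      simp [Real.exp_log ht]
    have h3 := (Real.continuous_sqrt.tendsto 0).comp h2
    rw [Real.sqrt_zero] at h3
    exact h3.congr fun t => Real.sqrt_sq (norm_nonneg _)
  rw [IsRajchman, tendsto_zero_iff_norm_tendsto_zero]
  have hab : Tendsto (fun ξ : ℝ => 2 * Real.pi * |ξ|) (comap (fun ξ : ℝ => |ξ|) atTop) atTop :=
    tendsto_comap.const_mul_atTop (by positivity)
  refine (h1.comp hab).congr fun ξ => ?_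
  rw [Function.comp_apply, measureFourier_eq_charFun, charFun_neg, RCLike.norm_conj]
  rcases abs_cases ξ with ⟨e, _⟩ | ⟨e, _⟩
  · rw [e]
  · rw [e, mul_neg, charFun_neg, RCLike.norm_conj]

theorem theorem1p2 {𝒜 : Type*} [Fintype 𝒜] (r b : 𝒜 → ℝ) (F : Set ℝ)
    (hF : IsSelfSimilarSet r b F) (hsing : ¬ ∃ x : ℝ, F = {x})
    (hirr : ∃ j l : 𝒜, j ≠ l ∧ Irrational (Real.log (r j) / Real.log (r l)))
    (μ : Measure ℝ) (hμ : IsSelfSimilarMeasure r b μ) :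
    IsRajchman μ := by
  obtain ⟨hprob, p, hp, hp1, hμ⟩ := hμ
  obtain ⟨j₀, l₀, -, hirr⟩ := hirr
  have hp0 : ∀ j, 0 < p j := fun j => (hp j).1
  have hna : NullSingletonClass μ := noAtoms_of_selfSimilar
    (fun j => ⟨hF.ratio_pos j, hF.ratio_lt_one j⟩) hp0 hp1 hμ (hF.not_forall_fixed hsing)
  set a : 𝒜 → ℝ := fun j => -Real.log (r j) with ha_def
  have ha : ∀ j, 0 < a j := fun j =>
    neg_pos.2 (Real.log_neg (hF.ratio_pos j) (hF.ratio_lt_one j))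
  have hirr' : Irrational (a j₀ / a l₀) := by simpa [ha_def, neg_div_neg_eq] using hirr
  set g : ℝ → ℝ := fun u => ‖charFun μ (Real.exp u)‖ ^ 2 with hg_def
  have hg : Continuous g := (continuous_charFun.comp Real.continuous_exp).norm.pow 2
  have hg0 : ∀ u, 0 ≤ g u := fun u => by positivity
  have hsub : ∀ u, g u ≤ ∑ j, p j * g (u - a j) := fun u => by
    refine (sq_norm_charFun_selfSimilar_le (fun j => (hp0 j).le) hp1 hμ (Real.exp u)).trans_eq ?_
    refine Finset.sum_congr rfl fun j _ => ?_
    simp only [hg_def, ha_def, sub_neg_eq_add, Real.exp_add, Real.exp_log (hF.ratio_pos j)]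
    rw [mul_comm (r j)]
  refine isRajchman_of_tendsto_exp (tendsto_order.2 ⟨fun c hc =>
    Eventually.of_forall fun u => hc.trans_le (hg0 u), fun c hc => ?_⟩)
  have hA : 0 ≤ ∑ j, a j := Finset.sum_nonneg fun j _ => (ha j).le
  have hlim := (tendsto_integral_sq_norm_charFun_exp μ
    (show -(∑ j, a j) - 1 ≤ 1 by linarith)).div_const (∑ j, p j * a j)
  rw [zero_div] at hlim
  -- A single window with small integral suffices, since it bounds `g` at all sufficiently large
  -- `u`.
  obtain ⟨s, hs⟩ := (hlim.eventually (gt_mem_nhds (half_pos hc))).exists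
  rw [show s + (-(∑ j, a j) - 1) = s - ∑ j, a j - 1 by ring] at hs
  filter_upwards [eventually_lt_of_le_average hp0 hp1 ha hirr' hg hg0 hsub s (half_pos hc)]
    with u hu
  simp only [hg_def] at hu
  linarith
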